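/- A \emph{stabilisation monoid} is a finite ordered monoid $(M,\cdot,\le)$ (with $a\le a'$, $b\le b'\Rightarrow ab\le a'b'$) together with a map $\sharp$ from the set of idempotents of $M$ to itself such that, for idempotents $e,f$: $e\le f\Rightarrow e^\sharp\le f^\sharp$; $e^\sharp\le e$; $(e^\sharp)^\sharp=e^\sharp$; $1^\sharp=1$; and $(ab)^\sharp=a(ba)^\sharp b$ whenever $ab$ and $ba$ are idempotent. An \emph{ideal} is a downward closed subset of $M$. Let $n\ge 0$. An \emph{$n$-computation} for a word $u$ over $M$ is a finite ordered tree, each node $x$ of which is labelled by some $v(x)\in M$, such that the leaves of the tree, read from left to right, correspond to the letters of a word from which $u$ is obtained by deleting some (possibly no) occurrences of the letter $1$, and such that for each leaf $x$ with letter $b$ one has $v(x)=b$, and each inner node $x$ with children $y_1,\dots,y_k$ satisfies one of: $k=2$ and $v(x)=v(y_1)v(y_2)$; or $2\le k\le n$ and $v(x)=e$; or $k>n$ and $v(x)=e^\sharp$, where in the last two cases $e=v(y_1)=\dots=v(y_k)$ is idempotent. Replacing every "$v(x)=$" by "$v(x)\le$" (resp. "$v(x)\ge$") gives \emph{$n$-under-computations}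 (resp. \emph{$n$-over-computations}). The value is the label of the root; the height is counted so that a single leaf has height $0$. Let $A$ be an alphabet, $h:A\to M$ (extended letter by letter to $\tilde h:A^*\to M^*$), and $I\subseteq M$ an ideal. For $p\in\mathbb N$ let $[M,h,I]^{--}_p(u)$ (resp. $[M,h,I]^{-}_p(u)$) be the infimum in $\mathbb N\cup\{\infty\}$ of the $n\ge0$ for which there is an $n$-under-computation (resp. $n$-computation) for $\tilde h(u)$ of height at most $p$ and value in $M\setminus I$, and let $[M,h,I]^{+}_p(u)$ (resp. $[M,h,I]^{++}_p(u)$) be the supremum of the $n+1$ for which there is an $n$-computation (resp. $n$-over-computation) for $\tilde h(u)$ of height at most $p$ and value in $I$ (with $\inf\emptyset=\infty$, $\sup\emptyset=0$). For $f,g:A^*\to\mathbb N\cup\{\infty\}$ write $f\approx g$ if $f\le\alpha\circ g$ and $g\le\alpha\circ f$ for some non-decreasing $\alpha:\mathbb N\to\mathbb N$ with $\alpha(n)\ge n$, extended by $\alpha(\infty)=\infty$. The triple $(M,h,I)$ \emph{recognises} $f$ if for all $p\ge 3|M|$ the four functions $[M,h,I]^{--}_p$, $[M,h,I]^{-}_p$,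 $[M,h,I]^{+}_p$, $[M,h,I]^{++}_p$ are all $\approx$-equivalent to $f$. Let $\Omega\geq 1$ be a multiple of $|M|!$, so that $x^\Omega$ is idempotent for all $x\in M$. A \emph{$\sharp$-expression} over $A$ is built from letters of $A$ by binary products $EF$ and a unary operation $E^{\omega\sharp}$. Its value is given by $\mathrm{val}(c)=h(c)$ for $c\in A$, $\mathrm{val}(EF)=\mathrm{val}(E)\,\mathrm{val}(F)$, $\mathrm{val}(E^{\omega\sharp})=(\mathrm{val}(E)^\Omega)^\sharp$, and its $n$-unfolding by $\mathrm{unf}(c,n)=c$, $\mathrm{unf}(EF,n)=\mathrm{unf}(E,n)\,\mathrm{unf}(F,n)$, and $\mathrm{unf}(E^{\omega\sharp},n)=\mathrm{unf}(E,n)\cdots\mathrm{unf}(E,n)$ ($n$ times). \textbf{Proposition.} Suppose $(M,h,I)$ recognises $f:A^*\to\mathbb N\cup\{\infty\}$, and let $E$ be a $\sharp$-expression over $A$ with value $a\in M$. If $a\in I$, then $f(\mathrm{unf}(E,\Omega n))\to\infty$ as $n\to\infty$ (in $\mathbb N\cup\{\infty\}$). If $a\notin I$, then there is $N\in\mathbb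 N$ such that $f(\mathrm{unf}(E,\Omega n))\le N$ for all $n\ge1$. -/

import Mathlib

/-- A stabilisation monoid: a finite ordered monoid with a stabilisation operator `stab`,
a map from idempotents to idempotents. -/
class StabilisationMonoid (M : Type*) extends Monoid M, PartialOrder M where
  finite : Finite M
  mul_le_mul_compat : ∀ a a' b b' : M, a ≤ a' → b ≤ b' → a * b ≤ a' * b'
  stab : {e : M // IsIdempotentElem e} → {e : M // IsIdempotentElem e}
  stab_mono : ∀ e f : {e : M // IsIdempotentElem e}, e.1 ≤ f.1 → (stab e).1 ≤ (stab f).1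
  stab_consistent : ∀ (a b : M) (hab : IsIdempotentElem (a * b)) (hba : IsIdempotentElem (b * a)),
    (stab ⟨a * b, hab⟩).1 = a * (stab ⟨b * a, hba⟩).1 * b
  stab_le : ∀ e : {e : M // IsIdempotentElem e}, (stab e).1 ≤ e.1
  stab_stab : ∀ e : {e : M // IsIdempotentElem e}, stab (stab e) = stab e
  stab_one : (stab ⟨1, IsIdempotentElem.one⟩).1 = 1

namespace StabilisationMonoid

/-! ### Computations -/

/-- Ordered unranked trees whose nodes are labelled by elements of `M`. -/
inductive LTree (M : Type*) where
  | leaf (v : M) : LTree M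
  | node (v : M) (k : ℕ) (y : Fin k → LTree M) : LTree M

namespace LTree

/-- The label of the root. -/
def value {M : Type*} : LTree M → M
  | leaf v => v
  | node v _ _ => v

/-- The height, leaves not being counted. -/
def height {M : Type*} : LTree M → ℕ
  | leaf _ => 0
  | node _ _ y => (Finset.univ.sup fun i => height (y i)) + 1

end LTree

/-- `IsComp R n T u`: the tree `T` satisfies the clauses of a computation of threshold `n` for the
word `u`, where the label `v` of a node and the element `s` obtained from the letter
(at a leaf) or from the labels of the children (at an inner node) have to satisfy `R v s`.
Taking `≤`, `=`, `≥` for `R` gives under-computations, computations and over-computations.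
The last three alternatives are binary, idempotent and stabilisation nodes. -/
def IsComp {M : Type*} [StabilisationMonoid M] (R : M → M → Prop) (n : ℕ) :
    LTree M → List M → Prop
  | .leaf v, u => ∃ a : M, u = [a] ∧ R v a
  | .node v k y, u =>
      (∃ w : Fin k → List M, u = (List.ofFn w).flatten ∧ ∀ i, IsComp R n (y i) (w i)) ∧
      ((∃ hk : k = 2, R v ((y ⟨0, by omega⟩).value * (y ⟨1, by omega⟩).value)) ∨
        (2 ≤ k ∧ k ≤ n ∧ ∃ e : {e : M // IsIdempotentElem e},
          (∀ i, (y i).value = e.1) ∧ R v e.1) ∨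
        (n < k ∧ ∃ e : {e : M // IsIdempotentElem e},
          (∀ i, (y i).value = e.1) ∧ R v (stab e).1))

/-- `ErasesOnes v u`: the word `u` is obtained from `v` by deleting some (possibly no)
occurrences of the letter `1`. -/
inductive ErasesOnes {M : Type*} [One M] : List M → List M → Prop where
  | nil : ErasesOnes [] []
  | keep (a : M) {v u : List M} : ErasesOnes v u → ErasesOnes (a :: v) (a :: u)
  | erase {v u : List M} : ErasesOnes v u → ErasesOnes (1 :: v) u

/-- The variant of computations for monoids: a computation for some word from which
`u` is obtained by deleting occurrences of `1`. -/
def IsSmComp {M : Type*} [StabilisationMonoid M] (R : M → M → Prop) (n : ℕ)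
    (T : LTree M) (u : List M) : Prop :=
  ∃ v : List M, ErasesOnes v u ∧ IsComp R n T v

/-! ### Recognised cost functions -/

section Semantics

variable {A M : Type*} [StabilisationMonoid M]

/-- Least `n` such that there is an `n`-under-computation of value outside `I` and height at most
`p` for the image of the word `u`. -/
noncomputable def semMM (h : A → M) (I : Set M) (p : ℕ) (u : List A) : ℕ∞ :=
  sInf {x : ℕ∞ | ∃ n : ℕ, x = n ∧
    ∃ T : LTree M, IsSmComp (fun a b => a ≤ b) n T (u.map h) ∧ T.height ≤ p ∧ T.value ∉ I}

/-- Least `n` such that there is an `n`-computation of value outside `I`, height at most `p`. -/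
noncomputable def semM (h : A → M) (I : Set M) (p : ℕ) (u : List A) : ℕ∞ :=
  sInf {x : ℕ∞ | ∃ n : ℕ, x = n ∧
    ∃ T : LTree M, IsSmComp (fun a b => a = b) n T (u.map h) ∧ T.height ≤ p ∧ T.value ∉ I}

/-- Supremum of the `n + 1` such that there is an `n`-computation of value in `I`, height at
most `p`. -/
noncomputable def semP (h : A → M) (I : Set M) (p : ℕ) (u : List A) : ℕ∞ :=
  sSup {x : ℕ∞ | ∃ n : ℕ, x = n + 1 ∧
    ∃ T : LTree M, IsSmComp (fun a b => a = b) n T (u.map h) ∧ T.height ≤ p ∧ T.value ∈ I}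

/-- Supremum of the `n + 1` such that there is an `n`-over-computation of value in `I`, height at
most `p`. -/
noncomputable def semPP (h : A → M) (I : Set M) (p : ℕ) (u : List A) : ℕ∞ :=
  sSup {x : ℕ∞ | ∃ n : ℕ, x = n + 1 ∧
    ∃ T : LTree M, IsSmComp (fun a b => b ≤ a) n T (u.map h) ∧ T.height ≤ p ∧ T.value ∈ I}

end Semantics

/-- Correction functions. -/
def IsCorrection (α : ℕ → ℕ) : Prop := Monotone α ∧ ∀ n, n ≤ α n

/-- `f` is dominated by `g` up to `α`, where `α` is extended by `α ∞ = ∞`. -/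
def DominatedBy {X : Type*} (α : ℕ → ℕ) (f g : X → ℕ∞) : Prop :=
  ∀ x, f x ≤ ENat.map α (g x)

/-- Equivalence of functions; its classes are the cost functions. -/
def CostEquiv {X : Type*} (f g : X → ℕ∞) : Prop :=
  ∃ α : ℕ → ℕ, IsCorrection α ∧ DominatedBy α f g ∧ DominatedBy α g f

/-- `f` belongs to the cost function recognised by `M, h, I`, that is to the (unique) class of
`CostEquiv` which contains the four functions above for all `p ≥ 3|M|`. -/
def Recognises {A M : Type*} [StabilisationMonoid M] (h : A → M) (I : Set M)
    (f : List A → ℕ∞) : Prop :=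
  ∀ p : ℕ, 3 * Nat.card M ≤ p →
    CostEquiv f (semMM h I p) ∧ CostEquiv f (semM h I p) ∧
    CostEquiv f (semP h I p) ∧ CostEquiv f (semPP h I p)

/-! ### Sharp-expressions -/

/-- `Ω` is a (positive) multiple of `|M|!`. -/
def IsOmegaExponent (M : Type*) (Ω : ℕ) : Prop := 0 < Ω ∧ (Nat.card M).factorial ∣ Ω

/-- In a finite monoid `a ^ Ω` is idempotent. -/
theorem isIdempotentElem_pow {M : Type*} [StabilisationMonoid M] {Ω : ℕ}
    (hΩ : IsOmegaExponent M Ω) (a : M) : IsIdempotentElem (a ^ Ω) := by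
  have : Finite M := finite
  have := Fintype.ofFinite M
  obtain ⟨hpos, hdvd⟩ := hΩ
  have hninj : ¬ Function.Injective (fun i : Fin (Nat.card M + 1) => a ^ (i : ℕ)) := by
    intro hinj
    have hle := Fintype.card_le_of_injective _ hinj
    rw [Fintype.card_fin, ← Nat.card_eq_fintype_card] at hle
    omega
  have key : ∃ i d : ℕ, 0 < d ∧ i + d ≤ Nat.card M ∧ a ^ (i + d) = a ^ i := by
    simp only [Function.Injective, not_forall] at hninj
    obtain ⟨i, j, hij, hne⟩ := hninj
    have hne' : (i : ℕ) ≠ j := fun h => hne (Fin.ext h)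
    rcases lt_or_gt_of_ne hne' with hlt | hlt
    · exact ⟨i, j - i, by omega, by omega, by
        rw [Nat.add_sub_cancel' hlt.le]; exact hij.symm⟩
    · exact ⟨j, i - j, by omega, by omega, by
        rw [Nat.add_sub_cancel' hlt.le]; exact hij⟩
  obtain ⟨i, d, hd, hid, heq⟩ := key
  have hiΩ : i ≤ Ω :=
    (by omega : i ≤ Nat.card M).trans ((Nat.self_le_factorial _).trans (Nat.le_of_dvd hpos hdvd))
  have hdΩ : d ∣ Ω := (Nat.dvd_factorial hd (by omega)).trans hdvd
  have hper : ∀ t : ℕ, a ^ (Ω + d * t) = a ^ Ω := by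
    intro t
    induction t with
    | zero => simp
    | succ t ih =>
      have h1 : Ω + d * (t + 1) = (i + d) + (Ω - i + d * t) := by
        rw [Nat.mul_succ]; omega
      have h2 : Ω + d * t = i + (Ω - i + d * t) := by omega
      rw [h1, pow_add, heq, ← pow_add, ← h2, ih]
  obtain ⟨t, ht⟩ := hdΩ
  have h3 := hper t
  rw [← ht, pow_add] at h3
  exact h3

/-- `a ↦ (a ^ Ω) ^ ♯`. -/
def osharp {M : Type*} [StabilisationMonoid M] {Ω : ℕ} (hΩ : IsOmegaExponent M Ω) (a : M) : M :=
  (stab ⟨a ^ Ω, isIdempotentElem_pow hΩ a⟩).1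

/-- Sharp-expressions over `A`. -/
inductive SharpExpr (A : Type*) where
  | letter (c : A) : SharpExpr A
  | mul (E F : SharpExpr A) : SharpExpr A
  | sharp (E : SharpExpr A) : SharpExpr A

namespace SharpExpr

/-- The value of a sharp-expression over the alphabet `A` whose letters are sent to `M` by `h`. -/
def val {A M : Type*} [StabilisationMonoid M] {Ω : ℕ} (hΩ : IsOmegaExponent M Ω) (h : A → M) :
    SharpExpr A → M
  | letter c => h c
  | mul E F => val hΩ h E * val hΩ h F
  | sharp E => osharp hΩ (val hΩ h E)

/-- The `n`-unfolding. -/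
def unf {A : Type*} : SharpExpr A → ℕ → List A
  | letter c, _ => [c]
  | mul E F, n => unf E n ++ unf F n
  | sharp E, n => (List.replicate n (unf E n)).flatten

end SharpExpr

end StabilisationMonoid

namespace StabilisationMonoid

/-! The unfolding of `E` imitates a computation: grouping the `Ω * n` copies produced by a sharp
into `n` blocks of `Ω`, each block evaluates to the idempotent `val ^ Ω` by binary nodes, and one
stabilisation node of arity `n` joins the blocks. For every threshold `m < n` this gives an exact
`m`-computation with value `E.val hΩ h` and height independent of `n`
(`SharpExpr.exists_hasComp_unf`). If the value is in `I`, these computations make `semP` at least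
`n`; otherwise the one with `m = 0` makes `semM` vanish. Recognition transfers both bounds to `f`.
-/

/-- There is an `m`-computation for `u` of height at most `p` and value `a`. -/
def HasComp {M : Type*} [StabilisationMonoid M] (m p : ℕ) (u : List M) (a : M) : Prop :=
  ∃ T : LTree M, IsComp (fun a b => a = b) m T u ∧ T.height ≤ p ∧ T.value = a

theorem ErasesOnes.refl {M : Type*} [One M] (u : List M) : ErasesOnes u u := by
  induction u with
  | nil => exact .nil
  | cons a u ih => exact .keep a ih

namespace HasComp

variable {M : Type*} [StabilisationMonoid M] {m p q : ℕ} {u w : List M} {a b : M}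

theorem mono (hu : HasComp m p u a) (hpq : p ≤ q) : HasComp m q u a := by
  obtain ⟨T, hT, hp, ha⟩ := hu
  exact ⟨T, hT, hp.trans hpq, ha⟩

theorem singleton (m : ℕ) (a : M) : HasComp m 0 [a] a :=
  ⟨.leaf a, ⟨a, rfl, rfl⟩, le_rfl, rfl⟩

theorem append (hu : HasComp m p u a) (hw : HasComp m p w b) :
    HasComp m (p + 1) (u ++ w) (a * b) := by
  obtain ⟨S, hS, hSp, rfl⟩ := hu
  obtain ⟨T, hT, hTp, rfl⟩ := hw
  refine ⟨.node (S.value * T.value) 2 ![S, T], ⟨⟨![u, w], by simp, ?_⟩, .inl ⟨rfl, rfl⟩⟩, ?_, rfl⟩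
  · intro i
    fin_cases i
    · exact hS
    · exact hT
  · refine Nat.succ_le_succ (Finset.sup_le fun i _ => ?_)
    fin_cases i
    · exact hSp
    · exact hTp

/-- A comb of `k` binary nodes. Its height grows with `k`, which is harmless because it is used only
with the fixed `k = Ω - 1`. -/
theorem pow_succ (hu : HasComp m p u a) (k : ℕ) :
    HasComp m (p + k) (List.replicate (k + 1) u).flatten (a ^ (k + 1)) := by
  induction k with
  | zero => simpa using hu
  | succ k ih =>
    rw [List.replicate_succ, List.flatten_cons, _root_.pow_succ']
    exact (hu.mono (Nat.le_add_right p k)).append ih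

theorem stab {n : ℕ} {e : {e : M // IsIdempotentElem e}} (hu : HasComp m p u e.1) (hmn : m < n) :
    HasComp m (p + 1) (List.replicate n u).flatten (stab e).1 := by
  obtain ⟨T, hT, hTp, he⟩ := hu
  -- For `m = 0`, `n = 1` this node has a single child, which the stabilisation clause allows.
  exact ⟨.node (StabilisationMonoid.stab e).1 n fun _ => T,
    ⟨⟨fun _ => u, by rw [List.ofFn_const], fun _ => hT⟩, .inr (.inr ⟨hmn, e, fun _ => he, rfl⟩)⟩,
    Nat.succ_le_succ (Finset.sup_le fun _ _ => hTp), rfl⟩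

end HasComp

theorem flatten_replicate_mul {X : Type*} (k n : ℕ) (u : List X) :
    (List.replicate (k * n) u).flatten =
      (List.replicate n (List.replicate k u).flatten).flatten := by
  induction n with
  | zero => simp
  | succ n ih =>
    rw [Nat.mul_succ, Nat.add_comm, List.replicate_add, List.flatten_append, ih,
      List.replicate_succ, List.flatten_cons]

/-- The `Ω * n`-unfoldings of a sharp-expression have computations of bounded height
whose value is that of the expression, for all thresholds below `n`. -/
theorem SharpExpr.exists_hasComp_unf {A M : Type*} [StabilisationMonoid M] (h : A → M) {Ω : ℕ}
    (hΩ : IsOmegaExponent M Ω) (E : SharpExpr A) :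
    ∃ p : ℕ, ∀ m n : ℕ, m < n → HasComp m p ((E.unf (Ω * n)).map h) (E.val hΩ h) := by
  induction E with
  | letter c => exact ⟨0, fun m n _ => HasComp.singleton m (h c)⟩
  | mul E F ihE ihF =>
    obtain ⟨p, hp⟩ := ihE
    obtain ⟨q, hq⟩ := ihF
    refine ⟨max p q + 1, fun m n hmn => ?_⟩
    rw [SharpExpr.unf, List.map_append]
    exact ((hp m n hmn).mono (le_max_left p q)).append ((hq m n hmn).mono (le_max_right p q))
  | sharp E ih =>
    obtain ⟨p, hp⟩ := ih
    obtain ⟨k, hk⟩ : ∃ k, Ω = k + 1 := ⟨Ω - 1, (Nat.succ_pred_eq_of_pos hΩ.1).symm⟩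
    refine ⟨p + k + 1, fun m n hmn => ?_⟩
    have hpow : HasComp m (p + k) (List.replicate Ω ((E.unf (Ω * n)).map h)).flatten
        (E.val hΩ h ^ Ω) := by
      have := (hp m n hmn).pow_succ k
      rwa [← hk] at this
    rw [SharpExpr.unf, List.map_flatten, List.map_replicate, flatten_replicate_mul]
    exact HasComp.stab (e := ⟨_, isIdempotentElem_pow hΩ _⟩) hpow hmn

variable {A M : Type*} [StabilisationMonoid M] {h : A → M} {I : Set M} {m p : ℕ} {u : List A}
  {a : M}

theorem HasComp.semM_le (hu : HasComp m p (u.map h) a) (ha : a ∉ I) :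
    semM h I p u ≤ m := by
  obtain ⟨T, hT, hp, rfl⟩ := hu
  exact sInf_le ⟨m, rfl, T, ⟨_, .refl _, hT⟩, hp, ha⟩

theorem HasComp.le_semP (hu : HasComp m p (u.map h) a) (ha : a ∈ I) :
    (m : ℕ∞) + 1 ≤ semP h I p u := by
  obtain ⟨T, hT, hp, rfl⟩ := hu
  exact le_sSup ⟨m, rfl, T, ⟨_, .refl _, hT⟩, hp, ha⟩

end StabilisationMonoid

theorem mainTheorem9 {A M : Type*} [StabilisationMonoid M] (h : A → M) (I : Set M)
    (hI : IsLowerSet I) (f : List A → ℕ∞) (hf : StabilisationMonoid.Recognises h I f)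
    (Ω : ℕ) (hΩ : StabilisationMonoid.IsOmegaExponent M Ω)
    (E : StabilisationMonoid.SharpExpr A) :
    (E.val hΩ h ∈ I →
      Filter.Tendsto (fun n : ℕ => f (E.unf (Ω * n))) Filter.atTop (nhds ⊤)) ∧
    (E.val hΩ h ∉ I →
      ∃ N : ℕ, ∀ n : ℕ, 1 ≤ n → f (E.unf (Ω * n)) ≤ (N : ℕ∞)) := by
  obtain ⟨p₀, hp₀⟩ := E.exists_hasComp_unf h hΩ
  -- The height bound must be at least `3|M|` for recognition and at least `p₀` for the
  -- computations. Kept are `f ≤ α ∘ semM` and `semP ≤ β ∘ f`.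
  obtain ⟨-, ⟨α, -, hα, -⟩, ⟨β, hβmono, -, hβ⟩, -⟩ := hf _ (le_max_left _ p₀)
  set p := max (3 * Nat.card M) p₀
  have hp : ∀ m n : ℕ, m < n →
      StabilisationMonoid.HasComp m p ((E.unf (Ω * n)).map h) (E.val hΩ h) :=
    fun m n hmn => (hp₀ m n hmn).mono (le_max_right _ _)
  refine ⟨fun ha => ?_, fun ha => ⟨α 0, fun n hn => ?_⟩⟩
  · rw [ENat.tendsto_nhds_top_iff_natCast_lt]
    intro K
    -- With threshold `β K < n` one gets `β K + 1 ≤ semP ≤ β (f _)`, impossible if `f _ ≤ K`.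
    filter_upwards [Filter.eventually_gt_atTop (β K)] with n hn
    by_contra! hle
    obtain ⟨r, hr⟩ := ENat.ne_top_iff_exists.mp (ne_top_of_le_ne_top (ENat.natCast_ne_top K) hle)
    have hrK : r ≤ K := by rw [← hr] at hle; exact_mod_cast hle
    have hsem := ((hp _ n hn).le_semP ha).trans (hβ _)
    rw [← hr, ENat.map_natCast] at hsem
    have hlt : β K + 1 ≤ β r := by
      rw [← Nat.cast_le (α := ℕ∞), Nat.cast_add, Nat.cast_one]
      exact hsem
    have := hβmono.1 hrK
    omega
  -- Threshold `0` is available for every `n ≥ 1`, so `α 0` bounds `f` uniformly.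
  · have hsem : StabilisationMonoid.semM h I p (E.unf (Ω * n)) = (0 : ℕ) :=
      le_antisymm ((hp 0 n hn).semM_le ha) (by simp)
    have hle := hα (E.unf (Ω * n))
    rwa [hsem, ENat.map_natCast] at hle
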